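/- Let $\mathbb T=\mathbb R/\mathbb Z$ and let $\mathcal C(\mathbb T)$ be the space of continuous complex-valued functions on $\mathbb T$, with the supremum norm. For $f\in\mathcal C(\mathbb T)$ and $n\ge 0$ let $S_nf(x)=\sum_{k=-n}^{n}\hat f(k)e^{2\pi i kx}$, where $\hat f(k)=\int_{\mathbb T}f(t)e^{-2\pi i kt}\,dt$, be the $n$-th partial sum of the Fourier series of $f$. Let $(\delta_n)_{n\ge 2}$ be a sequence of positive real numbers going to zero. Then for quasi-all functions $f\in\mathcal C(\mathbb T)$ (that is, for all $f$ in a residual subset of $\mathcal C(\mathbb T)$, a set containing a countable intersection of dense open sets), there exists a set $E\subset\mathbb T$ with Hausdorff dimension $1$ such that, for every $x\in E$, $$\limsup_{n\to+\infty}\frac{|S_nf(x)|}{\delta_n\log n}=+\infty.$$ -/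

import Mathlib

open Filter Topology

/-- The `n`-th symmetric partial sum `∑_{k=-n}^{n} f̂(k) e^{2πikx}` of the Fourier series of a
continuous function on the circle `ℝ/ℤ`. -/
noncomputable def fourierPartialSum (n : ℕ) (f : C(UnitAddCircle, ℂ)) (x : UnitAddCircle) : ℂ :=
  ∑ k ∈ Finset.Icc (-(n : ℤ)) (n : ℤ), fourierCoeff f k * fourier k x

/-! The function `e(nMx) (A - conj A)`, with `A = -log (1 - r e(nx))`, is bounded by `2π`, since `A
- conj A` is purely imaginary and `Im A` is an argument. The partial sum of order `nM` separates its
two halves: the frequencies above `nM` vanish and what remains is essentially `conj A`, which is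
large where `nx` is close to `0`. For `n = M = 2^a` and `r = 1 - 1/n` the partial sum of order `4^a`
is at least about `w log 2` on `nearDyadic a w`.

Since `D a = δ (4^a) log (4^a)` is `o(a)`, there are widths `w a = o(a)` that still dominate every
multiple of `D a`. Adding a small multiple of such a function to a trigonometric polynomial shows
that, for each `j`, the functions with a partial sum of order `4^a`, `a ≥ j`, exceeding `j * D a`
uniformly on `nearDyadic a (w a)` form a dense open set. Baire category then gives divergence at
every point lying in infinitely many of these sets.

Such points form a set of dimension 1. Along a sparse sequence of `a`, it suffices that the binary
digits vanish on the blocks `[a, a + w a)`, which have small density. Reading off the free digits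
maps these points onto `[0, 1]` and is Hölder of every exponent `s < 1`
(`abs_spreadDigits_id_le_rpow`). -/

/-! ### Spreading binary digits, and the Hölder inverse. -/

/-- The real number whose binary digits are the terms of `e`, the `i`-th one placed at
position `p i`. -/
noncomputable def spreadDigits (p : ℕ → ℕ) (e : ℕ → ℝ) : ℝ :=
  ∑' i, e i * (1 / 2 : ℝ) ^ (p i + 1)

theorem summable_spreadDigits {p : ℕ → ℕ} (hp : StrictMono p) {e : ℕ → ℝ}
    (he : ∀ i, |e i| ≤ 1) : Summable fun i => e i * (1 / 2 : ℝ) ^ (p i + 1) := by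
  refine Summable.of_norm_bounded (g := fun i => (1 / 2 : ℝ) ^ i) summable_geometric_two ?_
  intro i
  rw [norm_mul, Real.norm_eq_abs, Real.norm_of_nonneg (by positivity)]
  calc |e i| * (1 / 2 : ℝ) ^ (p i + 1) ≤ 1 * (1 / 2 : ℝ) ^ i := by
        refine mul_le_mul (he i) ?_ (by positivity) zero_le_one
        exact pow_le_pow_of_le_one (by norm_num) (by norm_num) ((hp.le_apply).trans (Nat.le_succ _))
    _ = _ := one_mul _

theorem abs_spreadDigits_le {p : ℕ → ℕ} (hp : StrictMono p) {e : ℕ → ℝ}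
    (he : ∀ i, |e i| ≤ 1) : |spreadDigits p e| ≤ (1 / 2 : ℝ) ^ p 0 := by
  have hle : ∀ i, p 0 + i ≤ p i := by
    intro i
    induction i with
    | zero => simp
    | succ i ih => have := hp (Nat.lt_succ_self i); simp at this; omega
  have hg : HasSum (fun i : ℕ => (1 / 2 : ℝ) ^ (p 0 + 1) * (1 / 2 : ℝ) ^ i)
      ((1 / 2 : ℝ) ^ (p 0 + 1) * 2) := hasSum_geometric_two.mul_left _
  have : ‖spreadDigits p e‖ ≤ (1 / 2 : ℝ) ^ (p 0 + 1) * 2 := by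
    refine tsum_of_norm_bounded hg fun i => ?_
    rw [norm_mul, Real.norm_eq_abs, Real.norm_of_nonneg (by positivity), ← pow_add]
    calc |e i| * (1 / 2 : ℝ) ^ (p i + 1) ≤ 1 * (1 / 2 : ℝ) ^ (p 0 + 1 + i) := by
          refine mul_le_mul (he i) ?_ (by positivity) zero_le_one
          exact pow_le_pow_of_le_one (by norm_num) (by norm_num) (by have := hle i; omega)
      _ = _ := one_mul _
  rw [Real.norm_eq_abs] at this
  calc _ ≤ _ := this
    _ = _ := by ring

theorem abs_spreadDigits_sub_sum_le {p : ℕ → ℕ} (hp : StrictMono p) {e : ℕ → ℝ}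
    (he : ∀ i, |e i| ≤ 1) (r : ℕ) :
    |spreadDigits p e - ∑ i ∈ Finset.range r, e i * (1 / 2 : ℝ) ^ (p i + 1)|
      ≤ (1 / 2 : ℝ) ^ p r := by
  have h := (summable_spreadDigits hp he).sum_add_tsum_nat_add r
  have h2 := abs_spreadDigits_le (p := fun i => p (i + r)) (e := fun i => e (i + r))
    (fun i j hij => hp (by omega)) (fun i => he _)
  simp only [spreadDigits, zero_add] at h2 ⊢
  rw [← h, add_sub_cancel_left]
  exact h2

/-- Either the two digit sums are separated at some index, or the partial sums up to `r`
are still in one of the three undecided states. -/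
theorem spreadDigits_trichotomy {p : ℕ → ℕ} (hp : StrictMono p) {e : ℕ → ℝ}
    (he : ∀ i, e i = -1 ∨ e i = 0 ∨ e i = 1) (r : ℕ) :
    (∃ k, |spreadDigits id e| ≤ 2 * (1 / 2 : ℝ) ^ k ∧
        (1 / 2 : ℝ) ^ (p k + 1) ≤ |spreadDigits p e|) ∨
      (∑ i ∈ Finset.range r, e i * (1 / 2 : ℝ) ^ (i + 1) = 0 ∧
        ∑ i ∈ Finset.range r, e i * (1 / 2 : ℝ) ^ (p i + 1) = 0) ∨
      (∑ i ∈ Finset.range r, e i * (1 / 2 : ℝ) ^ (i + 1) = (1 / 2 : ℝ) ^ r ∧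
        (1 / 2 : ℝ) ^ p r ≤ ∑ i ∈ Finset.range r, e i * (1 / 2 : ℝ) ^ (p i + 1)) ∨
      (∑ i ∈ Finset.range r, e i * (1 / 2 : ℝ) ^ (i + 1) = -(1 / 2 : ℝ) ^ r ∧
        ∑ i ∈ Finset.range r, e i * (1 / 2 : ℝ) ^ (p i + 1) ≤ -(1 / 2 : ℝ) ^ p r) := by
  have he1 : ∀ i, |e i| ≤ 1 := fun i => by rcases he i with h | h | h <;> simp [h]
  induction r with
  | zero => right; left; simp
  | succ r ih =>
    rcases ih with h | h
    · exact Or.inl h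
    have hpr : (1 / 2 : ℝ) ^ p (r + 1) ≤ (1 / 2 : ℝ) ^ (p r + 1) :=
      pow_le_pow_of_le_one (by norm_num) (by norm_num) (hp (Nat.lt_succ_self r))
    have hpos : (0 : ℝ) < (1 / 2 : ℝ) ^ p r := by positivity
    -- The full sum is compared with stage `r`, but the spread sum with stage `r + 1`: the gap
    -- between `p r` and `p (r + 1)` leaves at least half of `2^(-p r)` after subtracting the tail.
    have hD := abs_spreadDigits_sub_sum_le strictMono_id he1 r
    have hd := abs_spreadDigits_sub_sum_le hp he1 (r + 1)
    rw [abs_le] at hD hd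
    simp only [Finset.sum_range_succ, id] at hd hD ⊢
    have h1 : (1 / 2 : ℝ) ^ (p r + 1) = (1 / 2 : ℝ) ^ p r / 2 := by ring
    have h2 : (1 / 2 : ℝ) ^ (r + 1) = (1 / 2 : ℝ) ^ r / 2 := by ring
    rw [h1] at hpr hd ⊢
    rw [h2]
    have key : ∀ {A B : ℝ}, |A| ≤ 2 * (1 / 2 : ℝ) ^ r → (1 / 2 : ℝ) ^ p r / 2 ≤ |B| →
        (|A| ≤ 2 * (1 / 2 : ℝ) ^ r ∧ (1 / 2 : ℝ) ^ (p r + 1) ≤ |B|) := by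
      intro A B hA hB
      exact ⟨hA, h1 ▸ hB⟩
    rcases h with ⟨hu, hv⟩ | ⟨hu, hv⟩ | ⟨hu, hv⟩ <;> rcases he r with h | h | h <;>
      rw [hu] at hD ⊢ <;> rw [h] at hd ⊢
    -- A nonzero state survives only if the next digit has the opposite sign, the carry pattern `1,
    -- -1, -1, ...`; otherwise the sums separate with `k = r`.
    · right; right; right; constructor <;> linarith
    · right; left; constructor <;> linarith
    · right; right; left; constructor <;> linarith
    · right; right; left; constructor <;> linarith
    · left; exact ⟨r, key (abs_le.2 ⟨by linarith, by linarith⟩) (le_abs.2 (Or.inl (by linarith)))⟩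
    · left; exact ⟨r, key (abs_le.2 ⟨by linarith, by linarith⟩) (le_abs.2 (Or.inl (by linarith)))⟩
    · left; exact ⟨r, key (abs_le.2 ⟨by linarith, by linarith⟩) (le_abs.2 (Or.inr (by linarith)))⟩
    · left; exact ⟨r, key (abs_le.2 ⟨by linarith, by linarith⟩) (le_abs.2 (Or.inr (by linarith)))⟩
    · right; right; right; constructor <;> linarith

/-- If the digits never separate, all partial sums are `0` or `±2^(-r)`, so the full sum is `0`. The
double expansions of dyadic numbers fall in this case and do no harm, because the unspread sum only
needs an upper bound. -/
theorem spreadDigits_id_eq_zero_or {p : ℕ → ℕ} (hp : StrictMono p) {e : ℕ → ℝ}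
    (he : ∀ i, e i = -1 ∨ e i = 0 ∨ e i = 1) :
    spreadDigits id e = 0 ∨ ∃ k, |spreadDigits id e| ≤ 2 * (1 / 2 : ℝ) ^ k ∧
        (1 / 2 : ℝ) ^ (p k + 1) ≤ |spreadDigits p e| := by
  have he1 : ∀ i, |e i| ≤ 1 := fun i => by rcases he i with h | h | h <;> simp [h]
  by_contra! hcon
  obtain ⟨h0, hcon⟩ := hcon
  have hb : ∀ r : ℕ, |spreadDigits id e| ≤ 2 * (1 / 2 : ℝ) ^ r := by
    intro r
    have hD := abs_spreadDigits_sub_sum_le strictMono_id he1 r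
    have hpos : (0 : ℝ) < (1 / 2 : ℝ) ^ r := by positivity
    rw [abs_le] at hD ⊢
    simp only [id] at hD
    rcases spreadDigits_trichotomy hp he r with ⟨k, hk, hk'⟩ | h | h | h
    · exact absurd hk' (not_le.2 (hcon k hk))
    all_goals
      rw [h.1] at hD
      constructor <;> linarith
  have ht : Tendsto (fun r : ℕ => 2 * (1 / 2 : ℝ) ^ r) atTop (𝓝 (2 * 0)) :=
    (tendsto_pow_atTop_nhds_zero_of_lt_one (by norm_num) (by norm_num)).const_mul 2
  have := ge_of_tendsto' ht hb
  rw [mul_zero] at this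
  exact h0 (abs_nonpos_iff.1 this)

/-- If the positions grow at most linearly with slope `1 / s`, the inverse of spreading digits is
Hölder continuous of exponent `s`. -/
theorem abs_spreadDigits_id_le_rpow {p : ℕ → ℕ} (hp : StrictMono p) {s K : ℝ} (hs : 0 < s)
    (hps : ∀ r, s * (p r + 1) ≤ r + K) {e : ℕ → ℝ}
    (he : ∀ i, e i = -1 ∨ e i = 0 ∨ e i = 1) :
    |spreadDigits id e| ≤ 2 * 2 ^ K * |spreadDigits p e| ^ s := by
  rcases spreadDigits_id_eq_zero_or hp he with h | ⟨k, hk, hk'⟩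
  · rw [h, abs_zero]; positivity
  refine hk.trans ?_
  rw [mul_assoc]
  refine mul_le_mul_of_nonneg_left ?_ (by norm_num)
  have h1 : ((1 / 2 : ℝ) ^ (p k + 1)) ^ s ≤ |spreadDigits p e| ^ s :=
    Real.rpow_le_rpow (by positivity) hk' hs.le
  refine le_trans ?_ (mul_le_mul_of_nonneg_left h1 (by positivity))
  have h2 : ((1 / 2 : ℝ) ^ (p k + 1)) ^ s = (2 : ℝ) ^ (-(s * (p k + 1))) := by
    rw [← Real.rpow_natCast, ← Real.rpow_mul (by norm_num), one_div, Real.inv_rpow (by norm_num),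
      ← Real.rpow_neg (by norm_num)]
    congr 1
    push_cast
    ring
  have h3 : (1 / 2 : ℝ) ^ k = (2 : ℝ) ^ (-(k : ℝ)) := by
    rw [Real.rpow_neg (by norm_num), Real.rpow_natCast, one_div, inv_pow]
  rw [h2, h3, ← Real.rpow_add (by norm_num)]
  exact Real.rpow_le_rpow_of_exponent_le (by norm_num) (by linarith [hps k])

/-! ### Hausdorff dimension from Hölder parametrizations. -/

/-- A set parametrized by `ψ` has dimension at least `s` if a parametrization `u` of the unit
interval is Hölder of exponent `s` with respect to `ψ`. -/
theorem le_dimH_range_of_holder {β X : Type*} [MetricSpace X] (ψ : β → X)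
    (u : β → ℝ) (hu : Set.Icc (0 : ℝ) 1 ⊆ Set.range u) {s : NNReal} (hs : 0 < s) (C : NNReal)
    (h : ∀ b c, dist (u b) (u c) ≤ C * dist (ψ b) (ψ c) ^ (s : ℝ)) :
    (s : ENNReal) ≤ dimH (Set.range ψ) := by
  have hβ : Nonempty β := by
    obtain ⟨b, -⟩ := hu ⟨le_rfl, zero_le_one⟩
    exact ⟨b⟩
  -- `ψ` need not be injective, but the Hölder bound forces `u` to be constant on its fibres, so any
  -- choice of preimage gives the same `g`.
  set g : X → ℝ := u ∘ Function.invFun ψ with hg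
  have hψ : ∀ b, ψ (Function.invFun ψ (ψ b)) = ψ b := fun b => Function.invFun_eq ⟨b, rfl⟩
  have hH : HolderOnWith C s g (Set.range ψ) := by
    rintro _ ⟨b, rfl⟩ _ ⟨c, rfl⟩
    have := h (Function.invFun ψ (ψ b)) (Function.invFun ψ (ψ c))
    rw [hψ, hψ] at this
    rw [edist_dist, edist_dist, ENNReal.ofReal_rpow_of_nonneg dist_nonneg s.coe_nonneg,
      ← ENNReal.ofReal_coe_nnreal (p := C), ← ENNReal.ofReal_mul C.coe_nonneg]
    exact ENNReal.ofReal_le_ofReal this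
  have him : Set.Icc (0 : ℝ) 1 ⊆ g '' Set.range ψ := by
    intro t ht
    obtain ⟨b, rfl⟩ := hu ht
    refine ⟨ψ b, ⟨b, rfl⟩, ?_⟩
    have := h (Function.invFun ψ (ψ b)) b
    rw [hψ, dist_self, Real.zero_rpow (by exact_mod_cast hs.ne'), mul_zero] at this
    exact dist_le_zero.1 this
  have h1 : (1 : ENNReal) ≤ dimH (Set.Icc (0 : ℝ) 1) := by
    rw [← segment_eq_Icc zero_le_one, Real.dimH_segment zero_ne_one]
  have h2 := h1.trans ((dimH_mono him).trans (hH.dimH_image_le hs))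
  have hs0 : (s : ENNReal) ≠ 0 := by exact_mod_cast hs.ne'
  rwa [ENNReal.le_div_iff_mul_le (Or.inl hs0) (Or.inl ENNReal.coe_ne_top), one_mul] at h2

theorem dimH_unitAddCircle_le_one (E : Set UnitAddCircle) : dimH E ≤ 1 := by
  have hL : LipschitzWith 1 (fun x : ℝ => (x : UnitAddCircle)) := by
    refine LipschitzWith.of_dist_le_mul fun x y => ?_
    rw [dist_eq_norm, ← AddCircle.coe_sub, NNReal.coe_one, one_mul, Real.dist_eq]
    exact QuotientAddGroup.norm_mk_le_norm
  have h := hL.dimH_range_le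
  rw [Real.dimH_univ] at h
  refine (dimH_mono fun x _ => ?_).trans h
  obtain ⟨y, rfl⟩ := QuotientAddGroup.mk_surjective x
  exact ⟨y, rfl⟩

/-! ### Points close to dyadic rationals at sparse scales. -/

/-- The points of the circle at distance at most `2 ^ (-w)` from `0` after multiplication by
`2 ^ a`. -/
def nearDyadic (a w : ℕ) : Set UnitAddCircle :=
  {x | ∃ y : ℝ, |y| ≤ (1 / 2 : ℝ) ^ w ∧ ((2 ^ a : ℕ) : ℤ) • x = (y : UnitAddCircle)}

/-- A sparse union of blocks of integers can be avoided by an increasing sequence of nearly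
unit slope. -/
theorem exists_strictMono_avoiding_blocks {a w : ℕ → ℕ} {η : ℝ} (hη0 : 0 ≤ η) (hη1 : η < 1)
    (ha0 : 1 ≤ a 0) (ha : ∀ k, 2 * a k ≤ a (k + 1)) (hw : ∀ k, (w k : ℝ) ≤ η / 2 * a k) :
    ∃ p : ℕ → ℕ, StrictMono p ∧ (∀ r, 1 ≤ p r) ∧ (∀ r, (1 - η) * p r ≤ r + 1) ∧
      ∀ r k, a k ≤ p r → a k + w k ≤ p r := by
  classical
  set P : ℕ → Prop := fun j => 1 ≤ j ∧ ∀ k, a k ≤ j → a k + w k ≤ j with hP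
  -- The `a k` at least double, so the widths are dominated by a geometric series: the factor `η /
  -- 2` in `hw` becomes `η`.
  have hsum : ∀ k, (∑ j ∈ Finset.range (k + 1), (w j : ℝ)) ≤ η * a k := by
    intro k
    induction k with
    | zero =>
      have := hw 0
      have h0 : (0 : ℝ) ≤ η * a 0 := by positivity
      simp only [zero_add, Finset.sum_range_one]
      linarith
    | succ k ih =>
      rw [Finset.sum_range_succ]
      have h1 := hw (k + 1)
      have h2 : (2 : ℝ) * a k ≤ a (k + 1) := by exact_mod_cast ha k
      nlinarith
  have hcard : ∀ k N, N ≤ a k →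
      (((Finset.range N).filter fun j => ¬ P j).card : ℝ) ≤ 1 + ∑ j ∈ Finset.range k, (w j : ℝ) := by
    intro k N hN
    have hmono : StrictMono a := strictMono_nat_of_lt_succ fun k => by
      have h1 : ∀ k, 1 ≤ a k := fun k => by
        induction k with
        | zero => exact ha0
        | succ k ih => have := ha k; omega
      have := ha k; have := h1 k; omega
    have hsub : ((Finset.range N).filter fun j => ¬ P j) ⊆
        {0} ∪ (Finset.range k).biUnion fun j => Finset.Ico (a j) (a j + w j) := by
      intro j hj
      simp only [hP, Finset.mem_filter, Finset.mem_range, not_and, not_forall, not_le] at hj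
      obtain ⟨hjN, hj⟩ := hj
      simp only [Finset.mem_union, Finset.mem_singleton, Finset.mem_biUnion, Finset.mem_range,
        Finset.mem_Ico]
      rcases Nat.eq_zero_or_pos j with h | h
      · exact Or.inl h
      · obtain ⟨i, hi, hi'⟩ := hj h
        refine Or.inr ⟨i, ?_, hi, hi'⟩
        exact hmono.lt_iff_lt.1 (hi.trans_lt (hjN.trans_le hN))
    have h1 := (Finset.card_le_card hsub).trans (Finset.card_union_le _ _)
    have h2 := h1.trans (Nat.add_le_add_left Finset.card_biUnion_le _)
    simp only [Finset.card_singleton, Nat.card_Ico, Nat.add_sub_cancel_left] at h2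
    exact_mod_cast h2
  have hlarge : ∀ N : ℕ, ∃ k, N ≤ a k := fun N => by
    refine ⟨N, ?_⟩
    induction N with
    | zero => omega
    | succ N ih =>
      have h1 : ∀ k, 1 ≤ a k := fun k => by
        induction k with
        | zero => exact ha0
        | succ k ih => have := ha k; omega
      have := ha N; have := h1 N; omega
  have hcount : ∀ N : ℕ, (1 - η) * N ≤ Nat.count P N + 1 := by
    intro N
    -- For the first `k` with `N ≤ a k`, only blocks of smaller index meet `[0, N)`; the extra `1`
    -- counts the excluded position `0`.
    have hbad : (((Finset.range N).filter fun j => ¬ P j).card : ℝ) ≤ 1 + η * N := by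
      rcases h : Nat.find (hlarge N) with _ | k
      · have := hcard 0 N (h ▸ Nat.find_spec (hlarge N))
        have h0 : (0 : ℝ) ≤ η * N := by positivity
        simp only [Finset.range_zero, Finset.sum_empty] at this
        linarith
      · have h1 := hcard (k + 1) N (h ▸ Nat.find_spec (hlarge N))
        have h2 : a k < N := not_le.1 (Nat.find_min (hlarge N) (m := k) (by omega))
        have h3 : η * a k ≤ η * N := by gcongr
        have := hsum k
        linarith
    have htot := Finset.card_filter_add_card_filter_not (s := Finset.range N) P
    rw [← Nat.count_eq_card_filter_range, Finset.card_range] at htot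
    have : (Nat.count P N : ℝ) + (((Finset.range N).filter fun j => ¬ P j).card : ℝ) = N := by
      exact_mod_cast htot
    linarith
  have hinf : (Set.ofPred P).Infinite := by
    intro hfin
    obtain ⟨N, hN⟩ := exists_nat_gt ((hfin.toFinset.card + 1 : ℝ) / (1 - η))
    rw [div_lt_iff₀ (by linarith)] at hN
    have h1 := hcount N
    have h2 : (Nat.count P N : ℝ) ≤ hfin.toFinset.card := by
      exact_mod_cast Nat.count_le_card hfin N
    linarith
  have hmem : ∀ r, P (Nat.nth P r) := Nat.nth_mem_of_infinite hinf
  refine ⟨Nat.nth P, Nat.nth_strictMono hinf, fun r => (hmem r).1, fun r => ?_,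
    fun r k => (hmem r).2 k⟩
  have := hcount (Nat.nth P r)
  rwa [Nat.count_nth_of_infinite hinf] at this

/-- Multiplication by `2^a` turns the digits at positions below `a` into an integer; the others
start at `a + w` and contribute at most `2^(-w)`. -/
theorem coe_spreadDigits_mem_nearDyadic {p : ℕ → ℕ} (hp : StrictMono p) (b : ℕ → Fin 2) {a w : ℕ}
    (h : ∀ r, a ≤ p r → a + w ≤ p r) :
    ((spreadDigits p fun i => ((b i : ℕ) : ℝ) : ℝ) : UnitAddCircle) ∈ nearDyadic a w := by
  have he : ∀ i, |((b i : ℕ) : ℝ)| ≤ 1 := fun i => by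
    rw [Nat.abs_cast]; exact_mod_cast Nat.lt_succ_iff.1 (b i).2
  have hex : ∃ r, a ≤ p r := ⟨a, hp.le_apply⟩
  classical
  set r := Nat.find hex with hr
  have hlt : ∀ i < r, p i < a := fun i hi => not_le.1 (Nat.find_min hex hi)
  have hge : a + w ≤ p r := h r (Nat.find_spec hex)
  set x := spreadDigits p fun i => ((b i : ℕ) : ℝ)
  set S := ∑ i ∈ Finset.range r, ((b i : ℕ) : ℝ) * (1 / 2 : ℝ) ^ (p i + 1) with hS
  have hx : |x - S| ≤ (1 / 2 : ℝ) ^ p r := abs_spreadDigits_sub_sum_le hp he r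
  have hint : (2 : ℝ) ^ a * S = ((∑ i ∈ Finset.range r, (b i : ℕ) * 2 ^ (a - (p i + 1)) : ℕ) : ℤ) := by
    push_cast
    rw [hS, Finset.mul_sum]
    refine Finset.sum_congr rfl fun i hi => ?_
    have h1 := hlt i (Finset.mem_range.1 hi)
    obtain ⟨d, rfl⟩ : ∃ d, a = p i + 1 + d := ⟨a - (p i + 1), by omega⟩
    rw [Nat.add_sub_cancel_left, pow_add (2 : ℝ), one_div, inv_pow]
    field_simp
  refine ⟨2 ^ a * (x - S), ?_, ?_⟩
  · rw [abs_mul, abs_of_pos (by positivity : (0 : ℝ) < 2 ^ a)]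
    calc (2 : ℝ) ^ a * |x - S| ≤ 2 ^ a * (1 / 2 : ℝ) ^ (a + w) := by
          refine mul_le_mul_of_nonneg_left (hx.trans ?_) (by positivity)
          exact pow_le_pow_of_le_one (by norm_num) (by norm_num) hge
      _ = (1 / 2 : ℝ) ^ w := by rw [pow_add, ← mul_assoc, ← mul_pow]; norm_num
  · rw [mul_sub, hint, ← AddCircle.coe_zsmul]
    have hz : ∀ m : ℤ, ((m : ℝ) : UnitAddCircle) = 0 := fun m => by
      rw [AddCircle.coe_eq_zero_iff]; exact ⟨m, by simp⟩
    rw [AddCircle.coe_sub, hz, sub_zero]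
    congr 1
    simp

theorem spreadDigits_id_eq_ofDigits (b : ℕ → Fin 2) :
    spreadDigits id (fun i => ((b i : ℕ) : ℝ)) = Real.ofDigits b := by
  simp [spreadDigits, Real.ofDigits, Real.ofDigitsTerm]

theorem le_dimH_iInter_nearDyadic {a w : ℕ → ℕ} {s : NNReal} (hs0 : 0 < s) (hs1 : s ≤ 1)
    (ha0 : 1 ≤ a 0) (ha : ∀ k, 2 * a k ≤ a (k + 1))
    (hw : ∀ k, (w k : ℝ) ≤ (1 - s) / 2 * a k) :
    (s : ENNReal) ≤ dimH (⋂ k, nearDyadic (a k) (w k)) := by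
  have hs1' : (s : ℝ) ≤ 1 := by exact_mod_cast hs1
  have hs0' : (0 : ℝ) < s := by exact_mod_cast hs0
  obtain ⟨p, hp, hp1, hps, hpa⟩ := exists_strictMono_avoiding_blocks (η := 1 - s) (by linarith)
    (by linarith) ha0 ha hw
  rw [sub_sub_cancel] at hps
  set x : (ℕ → Fin 2) → ℝ := fun b => spreadDigits p fun i => ((b i : ℕ) : ℝ)
  have he : ∀ (b : ℕ → Fin 2) i, |((b i : ℕ) : ℝ)| ≤ 1 := fun b i => by
    rw [Nat.abs_cast]; exact_mod_cast Nat.lt_succ_iff.1 (b i).2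
  have hsub : ∀ {q : ℕ → ℕ}, StrictMono q → ∀ b c : ℕ → Fin 2,
      spreadDigits q (fun i => ((b i : ℕ) : ℝ)) - spreadDigits q (fun i => ((c i : ℕ) : ℝ)) =
        spreadDigits q fun i => ((b i : ℕ) : ℝ) - ((c i : ℕ) : ℝ) := by
    intro q hq b c
    simp only [spreadDigits]
    rw [← (summable_spreadDigits hq (he b)).tsum_sub (summable_spreadDigits hq (he c))]
    simp_rw [sub_mul]
  -- Position `0` is never used, so the points stay in `[0, 1/2]`, where circle distance equals real
  -- distance.
  have hx : ∀ b, x b ∈ Set.Icc (0 : ℝ) (1 / 2) := by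
    intro b
    have h1 : 0 ≤ x b := tsum_nonneg fun i => by positivity
    refine ⟨h1, ?_⟩
    have h2 := (le_abs_self _).trans (abs_spreadDigits_le hp (he b))
    refine h2.trans ?_
    simpa using pow_le_pow_of_le_one (by norm_num : (0 : ℝ) ≤ 1 / 2) (by norm_num) (hp1 0)
  have hdist : ∀ b c, dist (x b : UnitAddCircle) (x c : UnitAddCircle) = |x b - x c| := by
    intro b c
    rw [dist_eq_norm, ← AddCircle.coe_sub, AddCircle.norm_coe_eq_abs_iff 1 one_ne_zero, abs_le]
    have h1 := hx b
    have h2 := hx c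
    simp only [Set.mem_Icc, abs_one] at h1 h2 ⊢
    constructor <;> linarith
  refine (le_dimH_range_of_holder (fun b => (x b : UnitAddCircle)) (Real.ofDigits (b := 2))
    ?_ hs0 (2 * 2 ^ (2 : ℝ)) ?_).trans (dimH_mono ?_)
  · intro t ht
    obtain ⟨b, -, hb⟩ := Real.ofDigits_SurjOn (b := 2) (by norm_num) ht
    exact ⟨b, hb⟩
  · intro b c
    rw [hdist, hsub hp, Real.dist_eq, ← spreadDigits_id_eq_ofDigits, ← spreadDigits_id_eq_ofDigits,
      hsub strictMono_id]
    -- From `s * p r ≤ r + 1` and `s ≤ 1` one gets `s * (p r + 1) ≤ r + 2`, hence `K = 2`.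
    have := abs_spreadDigits_id_le_rpow hp (K := 2) hs0' (fun r => by linarith [hps r])
      (e := fun i => ((b i : ℕ) : ℝ) - ((c i : ℕ) : ℝ)) (fun i => by
        generalize b i = m
        generalize c i = n
        fin_cases m <;> fin_cases n <;> simp)
    exact_mod_cast this
  · rintro _ ⟨b, rfl⟩
    exact Set.mem_iInter.2 fun k =>
      coe_spreadDigits_mem_nearDyadic hp b fun r => hpa r k

/-! ### Partial sums as continuous linear functionals. -/

theorem norm_fourier_apply (k : ℤ) (x : UnitAddCircle) : ‖(fourier k x : ℂ)‖ = 1 := by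
  rw [fourier_apply, Circle.norm_coe]

theorem norm_fourierCoeff_le (f : C(UnitAddCircle, ℂ)) (k : ℤ) : ‖fourierCoeff f k‖ ≤ ‖f‖ := by
  have h : ∀ t : UnitAddCircle, ‖fourier (-k) t • f t‖ ≤ ‖f‖ := fun t => by
    rw [norm_smul, norm_fourier_apply, one_mul]
    exact f.norm_coe_le_norm t
  have := MeasureTheory.norm_integral_le_of_norm_le_const
    (μ := AddCircle.haarAddCircle (T := (1 : ℝ))) (Eventually.of_forall h)
  simpa [fourierCoeff] using this

theorem integrable_haarAddCircle (f : C(UnitAddCircle, ℂ)) :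
    MeasureTheory.Integrable f (AddCircle.haarAddCircle (T := (1 : ℝ))) :=
  f.continuous.integrable_of_hasCompactSupport (HasCompactSupport.of_compactSpace _)

/-- The `k`-th Fourier coefficient as a continuous linear functional. -/
noncomputable def fourierCoeffCLM (k : ℤ) : C(UnitAddCircle, ℂ) →L[ℂ] ℂ :=
  LinearMap.mkContinuous
    { toFun := fun f => fourierCoeff f k
      map_add' := fun f g => by
        rw [ContinuousMap.coe_add,
          fourierCoeff.add (integrable_haarAddCircle f) (integrable_haarAddCircle g)]
        rfl
      map_smul' := fun c f => fourierCoeff.const_smul f c k } 1 fun f => by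
    rw [one_mul]; exact norm_fourierCoeff_le f k

theorem fourierCoeffCLM_apply (k : ℤ) (f : C(UnitAddCircle, ℂ)) :
    fourierCoeffCLM k f = fourierCoeff f k := rfl

/-- The `n`-th partial sum of the Fourier series at `x` as a continuous linear functional. -/
noncomputable def fourierPartialSumCLM (n : ℕ) (x : UnitAddCircle) : C(UnitAddCircle, ℂ) →L[ℂ] ℂ :=
  ∑ k ∈ Finset.Icc (-(n : ℤ)) (n : ℤ), fourier k x • fourierCoeffCLM k

theorem fourierPartialSumCLM_apply (n : ℕ) (x : UnitAddCircle) (f : C(UnitAddCircle, ℂ)) :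
    fourierPartialSumCLM n x f = fourierPartialSum n f x := by
  simp [fourierPartialSumCLM, fourierPartialSum, fourierCoeffCLM_apply, mul_comm]

theorem norm_fourierPartialSum_le (n : ℕ) (f : C(UnitAddCircle, ℂ)) (x : UnitAddCircle) :
    ‖fourierPartialSum n f x‖ ≤ (2 * n + 1) * ‖f‖ := by
  have h : ∀ k ∈ Finset.Icc (-(n : ℤ)) (n : ℤ), ‖fourierCoeff f k * fourier k x‖ ≤ ‖f‖ := by
    intro k _
    rw [norm_mul, norm_fourier_apply, mul_one]
    exact norm_fourierCoeff_le f k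
  refine (norm_sum_le_of_le _ h).trans (le_of_eq ?_)
  have : ((n : ℤ) + 1 - -(n : ℤ)).toNat = 2 * n + 1 := by omega
  rw [Finset.sum_const, Int.card_Icc, nsmul_eq_mul, this]
  push_cast
  ring

theorem fourierPartialSum_fourier (n : ℕ) (k : ℤ) (x : UnitAddCircle) :
    fourierPartialSum n (fourier k) x = if |k| ≤ n then fourier k x else 0 := by
  rw [fourierPartialSum, fourierCoeff_fourier]
  simp [Pi.single_apply, abs_le]

theorem exists_bound_fourierPartialSum_of_mem_span {g : C(UnitAddCircle, ℂ)}
    (hg : g ∈ Submodule.span ℂ (Set.range (@fourier 1))) :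
    ∃ B : ℝ, ∀ n x, ‖fourierPartialSum n g x‖ ≤ B := by
  simp only [← fourierPartialSumCLM_apply]
  induction hg using Submodule.span_induction with
  | mem f hf =>
    obtain ⟨k, rfl⟩ := hf
    refine ⟨1, fun n x => ?_⟩
    rw [fourierPartialSumCLM_apply, fourierPartialSum_fourier]
    split_ifs
    · rw [norm_fourier_apply]
    · simp
  | zero => exact ⟨0, fun n x => by simp⟩
  | add f g _ _ hf hg =>
    obtain ⟨A, hA⟩ := hf
    obtain ⟨B, hB⟩ := hg
    exact ⟨A + B, fun n x => by
      rw [map_add]; exact (norm_add_le _ _).trans (add_le_add (hA n x) (hB n x))⟩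
  | smul c f _ hf =>
    obtain ⟨A, hA⟩ := hf
    exact ⟨‖c‖ * A, fun n x => by
      rw [map_smul, norm_smul]; exact mul_le_mul_of_nonneg_left (hA n x) (norm_nonneg _)⟩

theorem fourier_mul_eq_pow (n k : ℕ) (x : UnitAddCircle) :
    fourier ((n : ℤ) * k) x = (fourier n x) ^ k := by
  induction k with
  | zero => simp
  | succ k ih => rw [Nat.cast_succ, mul_add, mul_one, fourier_add, ih, pow_succ]

/-! ### Bounded functions with large partial sums. -/

/-- The modulated conjugate-type series
`e(nM x) ∑_{k ≥ 1} (r ^ k / k) (e(nk x) - e(-nk x))`. -/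
noncomputable def modulatedSawtooth (n M : ℕ) (r : ℝ) : C(UnitAddCircle, ℂ) :=
  ∑' k : ℕ, ((r ^ (k + 1) / (k + 1) : ℝ) : ℂ) •
    (fourier ((n : ℤ) * (M + (k + 1))) - fourier ((n : ℤ) * (M - (k + 1))))

theorem hasSum_modulatedSawtooth (n M : ℕ) {r : ℝ} (hr0 : 0 ≤ r) (hr1 : r < 1) :
    HasSum (fun k : ℕ => ((r ^ (k + 1) / (k + 1) : ℝ) : ℂ) •
      ((fourier ((n : ℤ) * (M + (k + 1))) - fourier ((n : ℤ) * (M - (k + 1))) :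
        C(UnitAddCircle, ℂ)))) (modulatedSawtooth n M r) := by
  refine Summable.hasSum ?_
  refine Summable.of_norm_bounded (g := fun k : ℕ => r ^ k * 2)
    ((summable_geometric_of_lt_one hr0 hr1).mul_right 2) fun k => ?_
  rw [norm_smul]
  refine mul_le_mul ?_ ?_ (norm_nonneg _) (by positivity)
  · rw [Complex.norm_real, Real.norm_of_nonneg (by positivity)]
    calc r ^ (k + 1) / (k + 1) ≤ r ^ (k + 1) / 1 := by gcongr; linarith [k.cast_nonneg (α := ℝ)]
      _ = r ^ (k + 1) := div_one _
      _ ≤ r ^ k := pow_le_pow_of_le_one hr0 hr1.le (Nat.le_succ k)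
  · refine (norm_sub_le _ _).trans ?_
    rw [fourier_norm, fourier_norm]
    norm_num

theorem hasSum_neg_log_one_sub_fourier (n : ℕ) {r : ℝ} (hr0 : 0 ≤ r) (hr1 : r < 1)
    (x : UnitAddCircle) :
    HasSum (fun k : ℕ => ((r ^ (k + 1) / (k + 1) : ℝ) : ℂ) * fourier ((n : ℤ) * (k + 1)) x)
      (-Complex.log (1 - r * fourier n x)) := by
  have hz : ‖(r : ℂ) * fourier n x‖ < 1 := by
    rw [norm_mul, norm_fourier_apply, mul_one, Complex.norm_real,
      Real.norm_of_nonneg hr0]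
    exact hr1
  convert Complex.hasSum_taylorSeries_neg_log' hz using 2 with k
  have := fourier_mul_eq_pow n (k + 1) x
  push_cast at this ⊢
  rw [this, mul_pow]
  ring

theorem fourier_mul_sub (n M k : ℤ) (x : UnitAddCircle) :
    fourier (n * (M - k)) x = fourier (n * M) x * starRingEnd ℂ (fourier (n * k) x) := by
  rw [mul_sub, sub_eq_add_neg, fourier_add, fourier_neg]

/-- Up to a unimodular factor the value is `A - conj A = 2i Im A`, where `A` is minus a principal
logarithm, so `|Im A| ≤ π`. -/
theorem norm_modulatedSawtooth_le (n M : ℕ) {r : ℝ} (hr0 : 0 ≤ r) (hr1 : r < 1) :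
    ‖modulatedSawtooth n M r‖ ≤ 2 * Real.pi := by
  rw [ContinuousMap.norm_le _ (by positivity)]
  intro x
  have h1 := hasSum_neg_log_one_sub_fourier n hr0 hr1 x
  have h2 := Complex.hasSum_conj'.2 h1
  have h3 := (h1.sub h2).mul_left (fourier ((n : ℤ) * M) x)
  have h4 := (ContinuousMap.evalCLM ℂ x).hasSum (hasSum_modulatedSawtooth n M hr0 hr1)
  have h5 : modulatedSawtooth n M r x = _ := h4.unique (by
    have hev : ∀ g : C(UnitAddCircle, ℂ), ContinuousMap.evalCLM ℂ x g = g x := fun _ => rfl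
    refine h3.congr_fun fun k => ?_
    rw [map_smul, map_sub, hev, hev, smul_eq_mul, map_mul, Complex.conj_ofReal, fourier_mul_sub,
      mul_add, fourier_add]
    ring)
  rw [h5, norm_mul, norm_fourier_apply, one_mul, Complex.sub_conj]
  rw [norm_mul, Complex.norm_I, mul_one, Complex.norm_real, Complex.neg_im, Complex.log_im,
    Real.norm_eq_abs, abs_mul, abs_neg]
  have := Complex.abs_arg_le_pi (1 - r * fourier n x)
  rw [abs_two]
  linarith

/-- Truncation at `nM` discards every `e(n(M + k))` and keeps `e(n(M - k))` exactly for `1 ≤ k ≤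
2M`. What is left is a truncated logarithm series, whose tail has coefficients at most `1 / (2M)`
times a geometric sequence. -/
theorem norm_log_sub_le_norm_fourierPartialSum (n M : ℕ) (hn : 0 < n) (hM : 0 < M) {r : ℝ}
    (hr0 : 0 ≤ r) (hr1 : r < 1) (x : UnitAddCircle) :
    ‖Complex.log (1 - r * fourier n x)‖ - 1 / (2 * M * (1 - r)) ≤
      ‖fourierPartialSum (n * M) (modulatedSawtooth n M r) x‖ := by
  set c : ℕ → ℂ := fun k => ((r ^ (k + 1) / (k + 1) : ℝ) : ℂ) with hc
  set z : ℕ → ℂ := fun k => fourier ((n : ℤ) * (k + 1)) x with hz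
  have h1 := hasSum_neg_log_one_sub_fourier n hr0 hr1 x
  set A := -Complex.log (1 - r * fourier n x) with hA
  have h2 : HasSum (fun k => c k * starRingEnd ℂ (z k)) (starRingEnd ℂ A) := by
    convert Complex.hasSum_conj'.2 h1 using 2 with k
    simp [hc, hz]
  have hS : fourierPartialSum (n * M) (modulatedSawtooth n M r) x =
      -(fourier ((n : ℤ) * M) x * ∑ k ∈ Finset.range (2 * M), c k * starRingEnd ℂ (z k)) := by
    have h4 := (fourierPartialSumCLM (n * M) x).hasSum (hasSum_modulatedSawtooth n M hr0 hr1)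
    rw [fourierPartialSumCLM_apply] at h4
    refine h4.unique ?_
    rw [Finset.mul_sum, ← Finset.sum_neg_distrib]
    have hn' : (0 : ℤ) < n := by exact_mod_cast hn
    have hterm : ∀ k : ℕ, (fourierPartialSumCLM (n * M) x)
        (((r ^ (k + 1) / (k + 1) : ℝ) : ℂ) •
          (fourier ((n : ℤ) * (M + (k + 1))) - fourier ((n : ℤ) * (M - (k + 1))))) =
        if k < 2 * M then -(fourier ((n : ℤ) * M) x * (c k * starRingEnd ℂ (z k))) else 0 := by
      intro k
      rw [map_smul, map_sub, fourierPartialSumCLM_apply, fourierPartialSumCLM_apply,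
        fourierPartialSum_fourier, fourierPartialSum_fourier]
      have h5 : ¬ |(n : ℤ) * (M + (k + 1))| ≤ ((n * M : ℕ) : ℤ) := by
        push_cast
        rw [abs_mul, abs_of_pos hn', mul_le_mul_iff_right₀ hn', abs_le]
        omega
      have h6 : |(n : ℤ) * (M - (k + 1))| ≤ ((n * M : ℕ) : ℤ) ↔ k < 2 * M := by
        push_cast
        rw [abs_mul, abs_of_pos hn', mul_le_mul_iff_right₀ hn', abs_le]
        omega
      rw [if_neg h5]
      simp only [h6]
      split_ifs
      · rw [fourier_mul_sub]
        simp only [hc, hz, smul_eq_mul]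
        ring
      · simp
    have h7 : HasSum (fun k => if k < 2 * M then
        -(fourier ((n : ℤ) * M) x * (c k * starRingEnd ℂ (z k))) else 0)
        (∑ k ∈ Finset.range (2 * M), if k < 2 * M then
          -(fourier ((n : ℤ) * M) x * (c k * starRingEnd ℂ (z k))) else 0) :=
      hasSum_sum_of_ne_finset_zero fun k hk => if_neg (by simpa using hk)
    convert h7 using 1
    · exact funext hterm
    · exact Finset.sum_congr rfl fun k hk => (if_pos (Finset.mem_range.1 hk)).symm
  have htail : ‖starRingEnd ℂ A - ∑ k ∈ Finset.range (2 * M), c k * starRingEnd ℂ (z k)‖ ≤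
      1 / (2 * M * (1 - r)) := by
    rw [← h2.tsum_eq, ← h2.summable.sum_add_tsum_nat_add (2 * M), add_sub_cancel_left]
    have hg := (hasSum_geometric_of_lt_one hr0 hr1).mul_left (1 / (2 * M : ℝ))
    have : (1 : ℝ) / (2 * M * (1 - r)) = 1 / (2 * M) * (1 - r)⁻¹ := by
      rw [one_div, mul_inv, one_div]
    rw [this]
    refine tsum_of_norm_bounded hg fun k => ?_
    rw [norm_mul, RCLike.norm_conj, hz]
    rw [norm_fourier_apply, mul_one, hc]
    rw [Complex.norm_real, Real.norm_of_nonneg (by positivity), div_mul_eq_mul_div, one_mul]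
    have hM' : (0 : ℝ) < M := by exact_mod_cast hM
    push_cast
    refine div_le_div₀ (by positivity) (pow_le_pow_of_le_one hr0 hr1.le (by omega)) (by positivity) ?_
    linarith [k.cast_nonneg (α := ℝ)]
  rw [hS, norm_neg, norm_mul, norm_fourier_apply, one_mul]
  have h8 := norm_sub_norm_le (starRingEnd ℂ A)
    (∑ k ∈ Finset.range (2 * M), c k * starRingEnd ℂ (z k))
  rw [RCLike.norm_conj] at h8
  have h9 : ‖A‖ = ‖Complex.log (1 - r * fourier n x)‖ := norm_neg _
  linarith

/-- There is a function of norm at most `2 * π` whose partial sum of order `4 ^ a` is of size at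
least comparable to `w` at all points of `nearDyadic a w`. -/
theorem exists_large_fourierPartialSum_on_nearDyadic {a w : ℕ} (hw : w ≤ a) :
    ∃ h : C(UnitAddCircle, ℂ), ‖h‖ ≤ 2 * Real.pi ∧ ∀ x ∈ nearDyadic a w,
      ((w : ℝ) - 3) * Real.log 2 - 1 ≤ ‖fourierPartialSum (4 ^ a) h x‖ := by
  set n : ℕ := 2 ^ a with hn
  have hn0 : 0 < n := by positivity
  have hn0' : (1 : ℝ) ≤ n := by exact_mod_cast hn0
  -- This `r` balances two needs: the truncation error stays at most `1`, and `1 - r = 2^(-a)` does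
  -- not exceed `2^(-w)`.
  set r : ℝ := 1 - 1 / n with hr
  have hr0 : 0 ≤ r := by rw [hr, sub_nonneg, div_le_one (by linarith)]; exact hn0'
  have hr1 : r < 1 := by rw [hr]; linarith [show (0 : ℝ) < 1 / n by positivity]
  refine ⟨modulatedSawtooth n n r, norm_modulatedSawtooth_le n n hr0 hr1, ?_⟩
  rintro x ⟨y, hy, hxy⟩
  have h4 : 4 ^ a = n * n := by rw [hn, ← mul_pow]; norm_num
  rw [h4]
  refine le_trans ?_ (norm_log_sub_le_norm_fourierPartialSum n n hn0 hn0 hr0 hr1 x)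
  have h5 : 1 / (2 * (n : ℝ) * (1 - r)) ≤ 1 := by
    rw [hr, sub_sub_cancel, mul_one_div, mul_div_cancel_right₀ _ (by linarith)]
    norm_num
  have hf : (fourier n x : ℂ) = Complex.exp (Complex.I * ((2 * Real.pi * y : ℝ) : ℂ)) := by
    rw [fourier_apply, hn, hxy, ← one_zsmul ((y : ℝ) : UnitAddCircle), ← fourier_apply,
      fourier_coe_apply]
    congr 1
    push_cast
    ring
  -- The constant is `8 ≥ 1 + 2π`; its logarithm is the loss `3 log 2` in the conclusion.
  have hb : ‖1 - r * fourier n x‖ ≤ 8 * (1 / 2 : ℝ) ^ w := by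
    have e1 : (1 : ℂ) - r * fourier n x =
        ((1 / n : ℝ) : ℂ) - r * (fourier n x - 1) := by
      rw [hr]; push_cast; ring
    have e2 : ‖(fourier n x : ℂ) - 1‖ ≤ 2 * Real.pi * (1 / 2 : ℝ) ^ w := by
      rw [hf]
      refine Real.norm_exp_I_mul_ofReal_sub_one_le.trans ?_
      rw [Real.norm_eq_abs, abs_mul, abs_of_pos (by positivity)]
      gcongr
    have e3 : (1 / n : ℝ) ≤ (1 / 2 : ℝ) ^ w := by
      rw [hn, Nat.cast_pow, Nat.cast_ofNat, ← one_div_pow]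
      exact pow_le_pow_of_le_one (by norm_num) (by norm_num) hw
    rw [e1]
    refine (norm_sub_le _ _).trans ?_
    rw [norm_mul, Complex.norm_real, Complex.norm_real, Real.norm_of_nonneg hr0,
      Real.norm_of_nonneg (by positivity)]
    have e4 : r * ‖(fourier n x : ℂ) - 1‖ ≤ 1 * (2 * Real.pi * (1 / 2 : ℝ) ^ w) :=
      mul_le_mul hr1.le e2 (norm_nonneg _) zero_le_one
    have e5 : (2 * Real.pi) * (1 / 2 : ℝ) ^ w ≤ 7 * (1 / 2 : ℝ) ^ w := by
      gcongr; linarith [Real.pi_lt_d2]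
    linarith
  have hpos : 0 < ‖1 - r * fourier n x‖ := by
    have := norm_sub_norm_le (1 : ℂ) (r * fourier n x)
    rw [norm_one, norm_mul, Complex.norm_real, Real.norm_of_nonneg hr0, norm_fourier_apply, mul_one] at this
    linarith
  have hlog := Real.log_le_log hpos hb
  rw [Real.log_mul (by norm_num) (by positivity), Real.log_pow, one_div, Real.log_inv,
    show (8 : ℝ) = 2 ^ 3 by norm_num, Real.log_pow] at hlog
  have hre := (neg_le_abs _).trans (Complex.abs_re_le_norm (Complex.log (1 - r * fourier n x)))
  rw [Complex.log_re] at hre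
  push_cast at hlog
  linarith

/-! ### The dense open sets. -/

/-- The uniform margin `c' > c` gives openness for an arbitrary set `S`; half of it absorbs a
perturbation, since the functionals have norm at most `2n + 1`. -/
theorem isOpen_setOf_fourierPartialSum_bounded_below (n : ℕ) (S : Set UnitAddCircle) (c : ℝ) :
    IsOpen {f : C(UnitAddCircle, ℂ) | ∃ c' > c, ∀ x ∈ S, c' ≤ ‖fourierPartialSum n f x‖} := by
  rw [Metric.isOpen_iff]
  rintro f ⟨c', hc', hf⟩
  have hn : (0 : ℝ) < 2 * n + 1 := by positivity
  refine ⟨(c' - c) / 2 / (2 * n + 1), by have : 0 < c' - c := sub_pos.2 hc'; positivity, ?_⟩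
  intro g hg
  refine ⟨(c + c') / 2, by linarith [show c < c' from hc'], fun x hx => ?_⟩
  rw [Metric.mem_ball, dist_comm, dist_eq_norm, lt_div_iff₀ hn] at hg
  have h1 := norm_fourierPartialSum_le n (f - g) x
  have h2 := hf x hx
  rw [← fourierPartialSumCLM_apply, map_sub, fourierPartialSumCLM_apply,
    fourierPartialSumCLM_apply] at h1
  have h3 := norm_sub_norm_le (fourierPartialSum n f x) (fourierPartialSum n g x)
  linarith

/-- Widths `w a = o(a)` that still dominate `D`, provided `D a = o(a)`. -/
theorem exists_width {t D : ℕ → ℝ} (ht : Tendsto t atTop (𝓝 0)) (ht0 : ∀ a, 0 < t a)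
    (htD : ∀ᶠ a : ℕ in atTop, D a ≤ a * t a) :
    ∃ w : ℕ → ℕ, (∀ η : ℝ, 0 < η → ∀ᶠ a in atTop, (w a : ℝ) ≤ η * a) ∧
      ∀ C : ℝ, 0 ≤ C → ∀ᶠ a in atTop, C * D a ≤ w a := by
  have hs : Tendsto (fun a => √(t a)) atTop (𝓝 0) := by
    simpa [Function.comp_def] using (Real.continuous_sqrt.tendsto 0).comp ht
  -- The geometric mean of `a` and `a * t a` is negligible against the first and dominates the
  -- second.
  refine ⟨fun a => ⌈a * √(t a)⌉₊, fun η hη => ?_, fun C hC => ?_⟩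
  · have h1 : ∀ᶠ a in atTop, √(t a) < η / 2 := hs.eventually (gt_mem_nhds (by positivity))
    have h2 : ∀ᶠ a : ℕ in atTop, 2 / η ≤ a := tendsto_natCast_atTop_atTop.eventually_ge_atTop _
    filter_upwards [h1, h2] with a h1 h2
    rw [div_le_iff₀ hη] at h2
    have h3 := (Nat.ceil_lt_add_one (by positivity : 0 ≤ (a : ℝ) * √(t a))).le
    have h4 : (a : ℝ) * √(t a) ≤ a * (η / 2) := by gcongr
    linarith
  · have h1 : ∀ᶠ a in atTop, √(t a) < 1 / (C + 1) := hs.eventually (gt_mem_nhds (by positivity))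
    filter_upwards [h1, htD] with a h1 h2
    rw [lt_div_iff₀ (by linarith)] at h1
    refine le_trans ?_ (Nat.le_ceil _)
    have h3 : t a = √(t a) * √(t a) := (Real.mul_self_sqrt (ht0 a).le).symm
    have h4 : 0 ≤ √(t a) := Real.sqrt_nonneg _
    have h5 : C * √(t a) ≤ 1 := by linarith
    calc C * D a ≤ C * (a * t a) := by gcongr
      _ = (a * √(t a)) * (C * √(t a)) := by linear_combination (C * a) * h3
      _ ≤ (a * √(t a)) * 1 := by gcongr
      _ = _ := mul_one _

/-- A trigonometric polynomial `g` near `f` has partial sums bounded by some `B`, so a small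
multiple `ρ • h` of a function with large partial sums decides the size at a suitable order. -/
theorem dense_setOf_large_fourierPartialSum {w : ℕ → ℕ} {D : ℕ → ℝ}
    (hwa : ∀ᶠ a in atTop, w a ≤ a)
    (hwD : ∀ C : ℝ, 0 ≤ C → ∀ᶠ a in atTop, C * (D a + 1) ≤ w a) (hD : ∀ᶠ a in atTop, 0 ≤ D a)
    (j : ℕ) :
    Dense {f : C(UnitAddCircle, ℂ) | ∃ a ≥ j, ∃ c > j * D a, ∀ x ∈ nearDyadic a (w a),
      c ≤ ‖fourierPartialSum (4 ^ a) f x‖} := by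
  have hdense : Dense (Submodule.span ℂ (Set.range (@fourier 1)) : Set C(UnitAddCircle, ℂ)) := by
    rw [dense_iff_closure_eq, ← Submodule.topologicalClosure_coe, span_fourier_closure_eq_top]
    rfl
  rw [Metric.dense_iff]
  intro f ε hε
  obtain ⟨g, hgf, hg⟩ := Metric.dense_iff.1 hdense f (ε / 2) (by positivity)
  obtain ⟨B, hB⟩ := exists_bound_fourierPartialSum_of_mem_span hg
  have hB0 : 0 ≤ B := (norm_nonneg _).trans (hB 0 0)
  set ρ : ℝ := ε / 2 / (2 * Real.pi + 1) with hρ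
  have hπ : 0 < 2 * Real.pi + 1 := by positivity
  have hρ0 : 0 < ρ := by positivity
  have hl : 0 < Real.log 2 := Real.log_pos (by norm_num)
  -- `K` collects the losses: the constants in the bound for `h` scaled by `ρ`, the bound `B`, and a
  -- margin `1` for the strict inequality.
  set K : ℝ := ρ * (3 * Real.log 2 + 1) + B + 1 with hK
  have hK0 : 0 ≤ K := by positivity
  obtain ⟨a, ha1, ha2, ha3, ha4⟩ := (hwa.and ((hwD ((j + K) / (ρ * Real.log 2))
    (by positivity)).and (hD.and (eventually_ge_atTop j)))).exists
  obtain ⟨h, hh, hhx⟩ := exists_large_fourierPartialSum_on_nearDyadic ha1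
  have hdom : j * D a + K ≤ ρ * Real.log 2 * w a := by
    rw [div_mul_eq_mul_div, div_le_iff₀ (by positivity)] at ha2
    have : (0 : ℝ) ≤ j := by positivity
    nlinarith [mul_nonneg hK0 ha3]
  refine ⟨g + (ρ : ℂ) • h, ?_, a, ha4, j * D a + 1, by simp, fun x hx => ?_⟩
  · rw [Metric.mem_ball] at hgf ⊢
    have h1 : dist (g + (ρ : ℂ) • h) g < ε / 2 := by
      rw [dist_eq_norm, add_sub_cancel_left, norm_smul, Complex.norm_real,
        Real.norm_of_nonneg hρ0.le]
      calc ρ * ‖h‖ ≤ ρ * (2 * Real.pi) := by gcongr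
        _ < ρ * (2 * Real.pi + 1) := by gcongr; linarith
        _ = ε / 2 := by rw [hρ]; field_simp
    linarith [dist_triangle (g + (ρ : ℂ) • h) g f]
  · have h1 := hhx x hx
    have h2 := hB (4 ^ a) x
    rw [← fourierPartialSumCLM_apply, map_add, map_smul, fourierPartialSumCLM_apply,
      fourierPartialSumCLM_apply, smul_eq_mul]
    have h3 := norm_sub_le_norm_add ((ρ : ℂ) * fourierPartialSum (4 ^ a) h x)
      (fourierPartialSum (4 ^ a) g x)
    rw [norm_mul, Complex.norm_real, Real.norm_of_nonneg hρ0.le, add_comm] at h3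
    have h4 := mul_le_mul_of_nonneg_left h1 hρ0.le
    nlinarith

/-! ### Dimension of the exceptional set and conclusion. -/

theorem dimH_setOf_frequently_nearDyadic {A : ℕ → ℕ} {w : ℕ → ℕ} (hA : ∀ j, j ≤ A j)
    (hw : ∀ η : ℝ, 0 < η → ∀ᶠ a in atTop, (w a : ℝ) ≤ η * a) :
    dimH {x | ∃ᶠ j in atTop, x ∈ nearDyadic (A j) (w (A j))} = 1 := by
  refine le_antisymm (dimH_unitAddCircle_le_one _) (ENNReal.le_of_forall_nnreal_lt fun s hs => ?_)
  have hs1 : s < 1 := by exact_mod_cast hs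
  rcases eq_or_ne s 0 with rfl | hs0
  · simp
  have hs1' : (s : ℝ) < 1 := by exact_mod_cast hs1
  obtain ⟨N, hN⟩ := eventually_atTop.1 (hw ((1 - s) / 2) (by linarith))
  -- Since `A j ≥ j`, this recursion makes `A (J k)` at least double at each step; starting from `N
  -- + 1` puts every scale in the range where `hN` applies.
  set J : ℕ → ℕ := fun k => (fun j => 2 * A j + 1)^[k] (N + 1) with hJ
  have hJs : ∀ k, J (k + 1) = 2 * A (J k) + 1 := fun k => by
    simp only [hJ, Function.iterate_succ_apply']
  have hJm : StrictMono J := strictMono_nat_of_lt_succ fun k => by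
    rw [hJs]; have := hA (J k); omega
  have hJN : ∀ k, N + 1 ≤ A (J k) := fun k => (hJm.monotone (Nat.zero_le k)).trans (hA _)
  refine (le_dimH_iInter_nearDyadic (a := fun k => A (J k)) (w := fun k => w (A (J k)))
    (pos_iff_ne_zero.2 hs0) hs1.le ?_ ?_ ?_).trans (dimH_mono fun x hx => ?_)
  · have := hJN 0; omega
  · intro k
    have := hA (J (k + 1))
    rw [hJs] at this
    simp only [hJs]
    omega
  · exact fun k => hN _ (by have := hJN k; omega)
  · exact frequently_atTop.2 fun m => ⟨J m, hJm.le_apply, Set.mem_iInter.1 hx m⟩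

theorem theorem5 (δ : ℕ → ℝ) (hδ_pos : ∀ n, 2 ≤ n → 0 < δ n)
    (hδ_lim : Tendsto δ atTop (𝓝 0)) :
    ∀ᶠ f in residual C(UnitAddCircle, ℂ),
      ∃ E : Set UnitAddCircle, dimH E = 1 ∧
        ∀ x ∈ E,
          limsup (fun n : ℕ =>
            ((‖fourierPartialSum n f x‖ / (δ n * Real.log n) : ℝ) : EReal)) atTop = ⊤ := by
  set D : ℕ → ℝ := fun a => δ (4 ^ a) * Real.log ((4 ^ a : ℕ) : ℝ) with hD
  have h4 : ∀ a, 1 ≤ a → 2 ≤ 4 ^ a := fun a ha =>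
    (by norm_num : 2 ≤ 4 ^ 1).trans (Nat.pow_le_pow_right (by norm_num) ha)
  have hDpos : ∀ a, 1 ≤ a → 0 < D a := fun a ha =>
    mul_pos (hδ_pos _ (h4 a ha)) (Real.log_pos (by exact_mod_cast h4 a ha))
  obtain ⟨w, hwη, hwD⟩ : ∃ w : ℕ → ℕ, (∀ η : ℝ, 0 < η → ∀ᶠ a in atTop, (w a : ℝ) ≤ η * a) ∧
      ∀ C : ℝ, 0 ≤ C → ∀ᶠ a in atTop, C * (D a + 1) ≤ w a := by
    have hpow : Tendsto (fun a : ℕ => 4 ^ a) atTop atTop :=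
      tendsto_pow_atTop_atTop_of_one_lt (by norm_num)
    -- The term `2 / (a + 1)` pays for the `+ 1` in `D a + 1` and keeps `t` positive; the absolute
    -- value covers `a = 0`, where the sign of `δ 1` is unknown.
    refine exists_width (t := fun a => |δ (4 ^ a)| * Real.log 4 + 2 / (a + 1)) ?_ ?_ ?_
    · have h1 := ((hδ_lim.comp hpow).abs.mul_const (Real.log 4)).add
        ((tendsto_one_div_add_atTop_nhds_zero_nat (𝕜 := ℝ)).const_mul 2)
      simpa [Function.comp_def, div_eq_mul_inv] using h1
    · intro a
      have : 0 ≤ Real.log 4 := Real.log_nonneg (by norm_num)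
      positivity
    · filter_upwards [eventually_ge_atTop 1] with a ha
      have ha' : (1 : ℝ) ≤ a := by exact_mod_cast ha
      have h1 : D a = a * (|δ (4 ^ a)| * Real.log 4) := by
        simp only [hD]
        rw [abs_of_pos (hδ_pos _ (h4 a ha)), Nat.cast_pow, Real.log_pow]
        push_cast
        ring
      have h2 : 1 ≤ (a : ℝ) * (2 / (a + 1)) := by
        rw [mul_div_assoc', le_div_iff₀ (by linarith)]; linarith
      rw [h1, mul_add]
      linarith
  have hwa : ∀ᶠ a in atTop, w a ≤ a := by
    filter_upwards [hwη 1 one_pos] with a ha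
    rw [one_mul] at ha
    exact_mod_cast ha
  have hres : ∀ᶠ f in residual C(UnitAddCircle, ℂ), ∀ j : ℕ, ∃ a ≥ j, ∃ c > j * D a,
      ∀ x ∈ nearDyadic a (w a), c ≤ ‖fourierPartialSum (4 ^ a) f x‖ := by
    rw [eventually_countable_forall]
    intro j
    refine residual_of_dense_open ?_ (dense_setOf_large_fourierPartialSum hwa hwD
      ((eventually_ge_atTop 1).mono fun a ha => (hDpos a ha).le) j)
    have : {f : C(UnitAddCircle, ℂ) | ∃ a ≥ j, ∃ c > j * D a, ∀ x ∈ nearDyadic a (w a),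
        c ≤ ‖fourierPartialSum (4 ^ a) f x‖} = ⋃ a ≥ j, {f : C(UnitAddCircle, ℂ) |
          ∃ c > j * D a, ∀ x ∈ nearDyadic a (w a), c ≤ ‖fourierPartialSum (4 ^ a) f x‖} := by
      ext f; simp
    exact this ▸ isOpen_biUnion fun a _ => isOpen_setOf_fourierPartialSum_bounded_below _ _ _
  filter_upwards [hres] with f hf
  choose A hA c hc hAc using hf
  refine ⟨_, dimH_setOf_frequently_nearDyadic hA hwη, fun x hx => ?_⟩
  refine EReal.eq_top_iff_forall_lt _ |>.2 fun y => ?_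
  refine lt_of_lt_of_le (b := ((y + 1 : ℝ) : EReal)) (by exact_mod_cast lt_add_one y) ?_
  refine le_limsup_of_frequently_le (frequently_atTop.2 fun N => ?_)
  obtain ⟨m, hm⟩ := exists_nat_ge (y + 1)
  -- The lower bound `1` on `j` gives `A j ≥ 1`, hence `D (A j) > 0`.
  obtain ⟨j, hj, hxj⟩ := frequently_atTop.1 hx (max (max N m) 1)
  have hj1 : 1 ≤ j := (le_max_right _ _).trans hj
  have hjN : N ≤ j := (le_max_left _ _).trans ((le_max_left _ _).trans hj)
  have hjm : m ≤ j := (le_max_right _ _).trans ((le_max_left _ _).trans hj)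
  refine ⟨4 ^ A j, ?_, ?_⟩
  · exact hjN.trans ((hA j).trans (Nat.lt_pow_self (by norm_num)).le)
  · have hDj := hDpos (A j) (hj1.trans (hA j))
    have h1 : (j : ℝ) * D (A j) ≤ ‖fourierPartialSum (4 ^ A j) f x‖ :=
      (hc j).le.trans (hAc j x hxj)
    have h2 : (j : ℝ) ≤ ‖fourierPartialSum (4 ^ A j) f x‖ / D (A j) := (le_div_iff₀ hDj).2 h1
    have h3 : (m : ℝ) ≤ j := by exact_mod_cast hjm
    exact EReal.coe_le_coe_iff.2 (hm.trans (h3.trans h2))
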